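/- For $h\in\mathbb{R}$ consider fields $\boldsymbol m:\mathbb{R}^2\to\mathbb{S}^2\subset\mathbb{R}^3$ with $\boldsymbol m-\hat{\boldsymbol e}_3\in H^1(\mathbb{R}^2;\mathbb{R}^3)$, $\hat{\boldsymbol e}_3=(0,0,1)$, and the energy \[ E(\boldsymbol m)=\int_{\mathbb{R}^2}\tfrac12|\nabla\boldsymbol m|^2+(\boldsymbol m-\hat{\boldsymbol e}_3)\cdot(\nabla\times\boldsymbol m)+\tfrac h2|\boldsymbol m-\hat{\boldsymbol e}_3|^2\,\mathrm dx, \qquad \nabla\times\boldsymbol m=(\partial_2m_3,\,-\partial_1m_3,\,\partial_1m_2-\partial_2m_1). \] Such a field $\boldsymbol m$ is called a critical point of $E$ if \[ \lim_{t\to0}\frac{E(\boldsymbol m_t)-E(\boldsymbol m)}{t}=0,\qquad \boldsymbol m_t=\frac{\boldsymbol m+t\boldsymbol\phi}{|\boldsymbol m+t\boldsymbol\phi|}, \] for every $\boldsymbol\phi\in L^\infty\cap H^1(\mathbb{R}^2;\mathbb{R}^3)$ with $\boldsymbol\phi\cdot\boldsymbol m=0$ almost everywhere. Proposition. Let $N\in\mathbb{Z}\setminus\{0,-1\}$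 and $\gamma\in\mathbb{R}$. Then, apart from the trivial field $\boldsymbol m=\hat{\boldsymbol e}_3$ (almost everywhere), there is no critical point $\boldsymbol m$ of $E$ of the form \[ \boldsymbol m(re^{\mathrm i\psi})=\bigl(e^{\mathrm i(\gamma-N\psi)}\sin\theta(r),\ \cos\theta(r)\bigr),\qquad r>0,\ \psi\in\mathbb{R}, \] with a function $\theta:(0,\infty)\to\mathbb{R}$, where $\mathbb{R}^2\cong\mathbb{C}$. -/

import Mathlib

open MeasureTheory Filter Topology
open scoped ContDiff

noncomputable section

namespace ChiralMagnet

/-- The target space `ℝ³` with its Euclidean norm. The plane `ℝ²` is identified with `ℂ`, so that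
the coordinate directions are `1` and `Complex.I`, and the volume of `ℂ` is Lebesgue measure. -/
abbrev R3 : Type := EuclideanSpace ℝ (Fin 3)

/-- The background state `e₃ = (0, 0, 1)`. -/
def e3 : R3 := !₂[0, 0, 1]

/-- `g` is the weak (distributional) derivative of `u : ℝ² → ℝ³` in the direction `v`. -/
def HasWeakPartial (v : ℂ) (u g : ℂ → R3) : Prop :=
  LocallyIntegrable u ∧ LocallyIntegrable g ∧
    ∀ ζ : ℂ → ℝ, ContDiff ℝ ∞ ζ → HasCompactSupport ζ →
      ∫ x, (fderiv ℝ ζ x v) • u x = -∫ x, ζ x • g x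

open scoped Classical in
/-- A representative of the weak derivative of `u` in the direction `v`
(unique almost everywhere), and `0` if there is no weak derivative. -/
def weakPartial (v : ℂ) (u : ℂ → R3) : ℂ → R3 :=
  if H : ∃ g, HasWeakPartial v u g then H.choose else 0

/-- `u` belongs to the Sobolev space `H¹(ℝ²; ℝ³)`: it is in `L²` and has weak partial derivatives
in `L²`. -/
def MemH1 (u : ℂ → R3) : Prop :=
  MemLp u 2 volume ∧
    (∃ g, HasWeakPartial 1 u g ∧ MemLp g 2 volume) ∧
    (∃ g, HasWeakPartial Complex.I u g ∧ MemLp g 2 volume)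

/-- `m` belongs to `H¹_{e₃}(ℝ²; 𝕊²)`: it takes values in the unit sphere almost everywhere and
`m - e₃` is in `H¹(ℝ²; ℝ³)`. -/
def MemH1Sphere (m : ℂ → R3) : Prop :=
  (∀ᵐ x, ‖m x‖ = 1) ∧ MemH1 (fun x => m x - e3)

/-- The curl `∇ × m = (∂₂m₃, -∂₁m₃, ∂₁m₂ - ∂₂m₁)` of a field `m : ℝ² → ℝ³` that does not depend on
the third variable. -/
def curl (m : ℂ → R3) (x : ℂ) : R3 :=
  !₂[weakPartial Complex.I m x 2,
     -weakPartial 1 m x 2,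
     weakPartial 1 m x 1 - weakPartial Complex.I m x 0]

/-- The energy
`E(m) = ∫ ½|∇m|² + (m - e₃) · (∇ × m) + (h/2)|m - e₃|² dx`
with the helicity term in the form that is integrable for all `m ∈ H¹_{e₃}(ℝ²; 𝕊²)`. -/
def energy (h : ℝ) (m : ℂ → R3) : ℝ :=
  ∫ x, ((1 / 2) * (‖weakPartial 1 m x‖ ^ 2 + ‖weakPartial Complex.I m x‖ ^ 2)
    + inner ℝ (m x - e3) (curl m x)
    + (h / 2) * ‖m x - e3‖ ^ 2)

/-- The variation `m_t = π(m + tφ) = (m + tφ) / |m + tφ|`. -/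
def variation (m φ : ℂ → R3) (t : ℝ) (x : ℂ) : R3 :=
  ‖m x + t • φ x‖⁻¹ • (m x + t • φ x)

/-- `φ` belongs to `L^∞ ∩ H¹(ℝ²; T_m 𝕊²)`. -/
def IsAdmissibleTangent (m φ : ℂ → R3) : Prop :=
  MemLp φ ⊤ volume ∧ MemH1 φ ∧ ∀ᵐ x, inner ℝ (φ x) (m x) = 0

/-- `m ∈ H¹_{e₃}(ℝ²; 𝕊²)` is a critical point of the energy: the first variation
`lim_{t → 0} (E(m_t) - E(m)) / t` vanishes for every `φ ∈ L^∞ ∩ H¹(ℝ²; T_m 𝕊²)`. -/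
def IsCriticalPoint (h : ℝ) (m : ℂ → R3) : Prop :=
  MemH1Sphere m ∧
    ∀ φ : ℂ → R3, IsAdmissibleTangent m φ →
      Tendsto (fun t : ℝ => (energy h (variation m φ t) - energy h m) / t) (𝓝[≠] 0) (𝓝 0)

/-- `m` is axisymmetric with winding `N` and phase `γ`: for some polar profile `θ`,
`m(r e^{iψ}) = (e^{i(γ - Nψ)} sin θ(r), cos θ(r))`. -/
def IsAxisymmetric (N : ℤ) (γ : ℝ) (m : ℂ → R3) : Prop :=
  ∃ θ : ℝ → ℝ, ∀ r : ℝ, 0 < r → ∀ ψ : ℝ,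
    m (r * Complex.exp (Complex.I * ψ)) =
      !₂[Real.cos (γ - N * ψ) * Real.sin (θ r),
         Real.sin (γ - N * ψ) * Real.sin (θ r),
         Real.cos (θ r)]

end ChiralMagnet

end

noncomputable section

namespace ChiralMagnet

/-! Let `n = e^{i(γ - Nψ)}` be the direction of the planar part of `m`, so that `i n` is always
tangent to the sphere at `m`. The planar test field `Φ = 2 W(|x|²) (x · n) i n`, with `W` supported
away from `0` and `∞`, expands to `W(|x|²) (i x + i e^{2iγ} x̄^{N+1} x^{-N})`, which is smooth.
Since `Φ` is orthogonal to both `m` and `e₃`, the `h`-term drops out of the first variation.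
Integration by parts moves all derivatives to `Φ` and gives `2 ∫ curl Φ (m₃ - 1) = ∫ m · ΔΦ`
(`IsCriticalPoint.integral_planar`), so no regularity of `m` or `θ` is needed.

Symmetry then removes all but one term (`integral_radial_eq_zero`). As `N + 1 ≠ 0`, there is a
rotation `a` with `a^{N+1} = -1`; it makes `Φ` equivariant and changes the sign of `m · ΔΦ`. Another
rotation changes the sign of the curl of the second summand of `Φ`, while `m₃` is radial. Only `curl
(W i x) = 2 (s W)'`, at `s = |x|²`, survives, so `∫ (s W)'(|x|²) (m₃ - 1) = 0`.

Letting the outer cutoff in `W` tend to infinity, which is allowed because `1 - m₃ = |m - e₃|²/2` is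
integrable, leaves a nonnegative weight that is positive outside a small disc. Since `m₃ ≤ 1`, it
follows that `m₃ = 1` there, hence `m = e₃`. -/

/-! ### Weak partial derivatives -/

theorem HasWeakPartial.ae_eq {v : ℂ} {u g g' : ℂ → R3} (h : HasWeakPartial v u g)
    (h' : HasWeakPartial v u g') : g =ᵐ[volume] g' := by
  refine ae_eq_of_integral_contDiff_smul_eq h.2.1 h'.2.1 fun ζ hζ hc => ?_
  have h1 := h.2.2 ζ hζ hc
  rw [h'.2.2 ζ hζ hc] at h1
  exact (neg_injective h1).symm

/-- Lets the arbitrarily chosen derivative in the energy be replaced by any explicit one. -/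
theorem HasWeakPartial.weakPartial_ae_eq {v : ℂ} {u g : ℂ → R3} (h : HasWeakPartial v u g) :
    weakPartial v u =ᵐ[volume] g := by
  have H : ∃ g, HasWeakPartial v u g := ⟨g, h⟩
  rw [weakPartial, dif_pos H]
  exact H.choose_spec.ae_eq h

theorem HasWeakPartial.congr_ae {v : ℂ} {u u' g : ℂ → R3} (h : HasWeakPartial v u g)
    (hu : u =ᵐ[volume] u') : HasWeakPartial v u' g := by
  refine ⟨h.1.congr hu, h.2.1, fun ζ hζ hc => ?_⟩
  rw [← h.2.2 ζ hζ hc]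
  refine integral_congr_ae ?_
  filter_upwards [hu] with x hx
  rw [hx]

theorem contDiff_fderiv_apply {F : Type*} [NormedAddCommGroup F] [NormedSpace ℝ F] {u : ℂ → F}
    (hu : ContDiff ℝ ∞ u) (v : ℂ) : ContDiff ℝ ∞ fun x => fderiv ℝ u x v :=
  (hu.fderiv_right (m := ∞) (by simp)).clm_apply contDiff_const

theorem hasCompactSupport_fderiv_apply {F : Type*} [NormedAddCommGroup F] [NormedSpace ℝ F]
    {u : ℂ → F} (hu : HasCompactSupport u) (v : ℂ) :
    HasCompactSupport fun x => fderiv ℝ u x v :=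
  hu.fderiv_apply (𝕜 := ℝ) v

theorem integrable_test_smul {F : Type*} [NormedAddCommGroup F] [NormedSpace ℝ F] {ζ : ℂ → ℝ}
    {u : ℂ → F} (hζ : Continuous ζ) (hc : HasCompactSupport ζ) (hu : LocallyIntegrable u) :
    Integrable fun x => ζ x • u x :=
  hu.integrable_smul_left_of_hasCompactSupport hζ hc

theorem integrable_fderiv_smul {F : Type*} [NormedAddCommGroup F] [NormedSpace ℝ F] {ζ : ℂ → ℝ}
    {u : ℂ → F} (hζ : ContDiff ℝ ∞ ζ) (hc : HasCompactSupport ζ) (hu : LocallyIntegrable u)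
    (v : ℂ) : Integrable fun x => fderiv ℝ ζ x v • u x :=
  integrable_test_smul (contDiff_fderiv_apply hζ v).continuous
    (hasCompactSupport_fderiv_apply hc v) hu

theorem HasWeakPartial.add {v : ℂ} {u u' g g' : ℂ → R3} (h : HasWeakPartial v u g)
    (h' : HasWeakPartial v u' g') :
    HasWeakPartial v (fun x => u x + u' x) (fun x => g x + g' x) := by
  refine ⟨h.1.add h'.1, h.2.1.add h'.2.1, fun ζ hζ hc => ?_⟩
  simp only [smul_add]
  rw [integral_add (integrable_fderiv_smul hζ hc h.1 v) (integrable_fderiv_smul hζ hc h'.1 v),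
    integral_add (integrable_test_smul hζ.continuous hc h.2.1)
      (integrable_test_smul hζ.continuous hc h'.2.1), h.2.2 ζ hζ hc, h'.2.2 ζ hζ hc, neg_add]

theorem HasWeakPartial.of_contDiff {u : ℂ → R3} (hu : ContDiff ℝ ∞ u) (v : ℂ) :
    HasWeakPartial v u (fun x => fderiv ℝ u x v) := by
  have hu' := (contDiff_fderiv_apply hu v).continuous.locallyIntegrable (μ := volume)
  have hu0 := hu.continuous.locallyIntegrable (μ := volume)
  refine ⟨hu0, hu', fun ζ hζ hc => ?_⟩
  rw [integral_smul_fderiv_eq_neg_fderiv_smul_of_integrable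
    (integrable_fderiv_smul hζ hc hu0 v) (integrable_test_smul hζ.continuous hc hu')
    (integrable_test_smul hζ.continuous hc hu0)
    (fun x _ => (hζ.differentiable (by simp)).differentiableAt)
    (fun x _ => (hu.differentiable (by simp)).differentiableAt), neg_neg]

theorem HasWeakPartial.contDiff_smul {v : ℂ} {u g : ℂ → R3} (h : HasWeakPartial v u g)
    {s : ℂ → ℝ} (hs : ContDiff ℝ ∞ s) :
    HasWeakPartial v (fun x => s x • u x) (fun x => fderiv ℝ s x v • u x + s x • g x) := by
  have hs' := (contDiff_fderiv_apply hs v).continuous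
  have l1 : LocallyIntegrable (fun x => fderiv ℝ s x v • u x) := h.1.continuous_smul hs'
  have l2 : LocallyIntegrable (fun x => s x • g x) := h.2.1.continuous_smul hs.continuous
  have l0 : LocallyIntegrable (fun x => s x • u x) := h.1.continuous_smul hs.continuous
  refine ⟨l0, l1.add l2, fun ζ hζ hc => ?_⟩
  have key := h.2.2 (fun x => ζ x * s x) (hζ.mul hs) hc.mul_right
  have e : ∀ x, fderiv ℝ (fun x => ζ x * s x) x v = ζ x * fderiv ℝ s x v + s x * fderiv ℝ ζ x v := by
    intro x
    rw [fderiv_fun_mul (hζ.differentiable (by simp)).differentiableAt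
      (hs.differentiable (by simp)).differentiableAt]
    simp
  simp only [e, add_smul, mul_smul, smul_add] at key ⊢
  have i1 := integrable_test_smul hζ.continuous hc l1
  have i2 := integrable_test_smul hζ.continuous hc l2
  have i0 := integrable_fderiv_smul hζ hc l0 v
  have i0' : Integrable (fun x => s x • fderiv ℝ ζ x v • u x) :=
    i0.congr (Eventually.of_forall fun x => smul_comm _ _ _)
  rw [integral_add i1 i0'] at key
  rw [integral_add i1 i2]
  simp only [smul_comm (fderiv ℝ ζ _ v) (s _)]
  rw [neg_add, ← key]
  abel

theorem HasWeakPartial.integral_fderiv_mul_apply {v : ℂ} {u g : ℂ → R3}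
    (h : HasWeakPartial v u g) {ζ : ℂ → ℝ} (hζ : ContDiff ℝ ∞ ζ) (hc : HasCompactSupport ζ)
    (i : Fin 3) : ∫ x, fderiv ℝ ζ x v * u x i = -∫ x, ζ x * g x i := by
  have h1 := congrArg (EuclideanSpace.proj (𝕜 := ℝ) i) (h.2.2 ζ hζ hc)
  rw [map_neg, ← ContinuousLinearMap.integral_comp_comm _ (integrable_fderiv_smul hζ hc h.1 v),
    ← ContinuousLinearMap.integral_comp_comm _
      (integrable_test_smul hζ.continuous hc h.2.1)] at h1
  simpa using h1

theorem locallyIntegrable_apply {u : ℂ → R3} (h : LocallyIntegrable u) (i : Fin 3) :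
    LocallyIntegrable fun x => u x i :=
  h.mono ((EuclideanSpace.proj (𝕜 := ℝ) i).continuous.comp_aestronglyMeasurable
    h.aestronglyMeasurable) (Eventually.of_forall fun x => PiLp.norm_apply_le (u x) i)

theorem HasWeakPartial.integral_inner_fderiv {v : ℂ} {u g : ℂ → R3}
    (h : HasWeakPartial v u g) {φ : ℂ → R3} (hφ : ContDiff ℝ ∞ φ) (hc : HasCompactSupport φ) :
    ∫ x, inner ℝ (u x) (fderiv ℝ φ x v) = -∫ x, inner ℝ (g x) (φ x) := by
  have hφi (i : Fin 3) : ContDiff ℝ ∞ fun x => φ x i := by fun_prop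
  have hci (i : Fin 3) : HasCompactSupport fun x => φ x i :=
    hc.comp_left (g := fun y : R3 => y i) rfl
  have e (i : Fin 3) (x : ℂ) : fderiv ℝ (fun x => φ x i) x v = fderiv ℝ φ x v i := by
    have := ((EuclideanSpace.proj i : R3 →L[ℝ] ℝ).hasFDerivAt.comp x
      ((hφ.differentiable (by simp)).differentiableAt (x := x)).hasFDerivAt)
    exact congrArg (fun T : ℂ →L[ℝ] ℝ => T v) this.fderiv
  have key (i : Fin 3) := h.integral_fderiv_mul_apply (hφi i) (hci i) i
  simp only [e] at key
  simp only [PiLp.inner_apply, RCLike.inner_apply, conj_trivial]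
  rw [integral_finsetSum, integral_finsetSum, ← Finset.sum_neg_distrib]
  · exact Finset.sum_congr rfl fun i _ => key i
  · exact fun i _ => integrable_test_smul (hφi i).continuous (hci i) (locallyIntegrable_apply h.2.1 i)
  · intro i _
    simpa only [e, smul_eq_mul] using integrable_fderiv_smul (hφi i) (hci i) (locallyIntegrable_apply h.1 i) v

/-! ### First variation of the energy -/

/-- A continuous quadratic functional on `L²` is differentiable along curves `a + t b + O(t²)`. -/
theorem tendsto_quadratic_difference_quotient {X J : Type*} [MeasurableSpace X] {μ : Measure X}
    [NormedAddCommGroup J] [NormedSpace ℝ J] (B : J →L[ℝ] J →L[ℝ] ℝ) {a b : X → J}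
    (ha : MemLp a 2 μ) (hb : MemLp b 2 μ) {c : ℝ → X → J}
    (hc : ∀ t, AEStronglyMeasurable (c t) μ) {k : X → ℝ} (hk : MemLp k 2 μ)
    (hck : ∀ t : ℝ, |t| ≤ 1 → ∀ᵐ x ∂μ, ‖c t x‖ ≤ t ^ 2 * k x) :
    Tendsto (fun t : ℝ => (∫ x, B (a x + t • b x + c t x) (a x + t • b x + c t x) ∂μ
      - ∫ x, B (a x) (a x) ∂μ) / t) (𝓝[≠] 0) (𝓝 (∫ x, (B (a x) (b x) + B (b x) (a x)) ∂μ)) := by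
  have hB {u v : X → J} (hu : MemLp u 2 μ) (hv : MemLp v 2 μ) :
      Integrable (fun x => B (u x) (v x)) μ := by
    refine ((hu.norm.integrable_mul hv.norm).const_mul ‖B‖).mono'
      (B.aestronglyMeasurable_comp₂ hu.1 hv.1) (Eventually.of_forall fun x => ?_)
    simpa [mul_assoc] using B.le_opNorm₂ (u x) (v x)
  -- Integrable majorant of the second-order remainder `B(a, c) + B(c, a) + B(t b + c, t b + c)`,
  -- divided by `t²`; it uses `t² ≤ |t|` for `|t| ≤ 1`.
  set G : X → ℝ := fun x => ‖B‖ * (2 * (‖a x‖ * |k x|) + (‖b x‖ + |k x|) ^ 2) with hG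
  have hGi : Integrable G μ := by
    refine Integrable.const_mul (Integrable.add ?_ ?_) _
    · exact (ha.norm.integrable_mul hk.norm).const_mul 2
    · exact (hb.norm.add hk.norm).integrable_sq
  have hpt (t : ℝ) (ht : |t| ≤ 1) : ∀ᵐ x ∂μ,
      ‖B (a x + t • b x + c t x) (a x + t • b x + c t x) - B (a x) (a x)
        - t * (B (a x) (b x) + B (b x) (a x))‖ ≤ t ^ 2 * G x := by
    filter_upwards [hck t ht] with x hx
    have e : B (a x + t • b x + c t x) (a x + t • b x + c t x) - B (a x) (a x)
        - t * (B (a x) (b x) + B (b x) (a x))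
        = B (a x) (c t x) + B (c t x) (a x) + B (t • b x + c t x) (t • b x + c t x) := by
      simp only [map_add, map_smul, add_apply, smul_apply,
        smul_eq_mul]
      ring
    rw [e]
    have hx' : ‖c t x‖ ≤ t ^ 2 * |k x| := hx.trans (by gcongr; exact le_abs_self _)
    have h1 : ‖B (a x) (c t x)‖ ≤ ‖B‖ * ‖a x‖ * (t ^ 2 * |k x|) :=
      (B.le_opNorm₂ _ _).trans (by gcongr)
    have h2 : ‖B (c t x) (a x)‖ ≤ ‖B‖ * (t ^ 2 * |k x|) * ‖a x‖ :=
      (B.le_opNorm₂ _ _).trans (by gcongr)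
    have hd : ‖t • b x + c t x‖ ≤ |t| * (‖b x‖ + |k x|) := by
      refine (norm_add_le _ _).trans ?_
      rw [norm_smul, Real.norm_eq_abs, mul_add]
      gcongr
      refine hx'.trans ?_
      gcongr
      rw [← sq_abs]
      nlinarith [abs_nonneg t]
    have h3 : ‖B (t • b x + c t x) (t • b x + c t x)‖
        ≤ ‖B‖ * (|t| * (‖b x‖ + |k x|)) * (|t| * (‖b x‖ + |k x|)) :=
      (B.le_opNorm₂ _ _).trans (by gcongr)
    refine (norm_add₃_le).trans ((add_le_add (add_le_add h1 h2) h3).trans_eq ?_)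
    rw [hG, ← sq_abs t]
    ring
  have hat (t : ℝ) (ht : |t| ≤ 1) : MemLp (fun x => a x + t • b x + c t x) 2 μ := by
    refine (ha.add (hb.const_smul t)).add (MemLp.of_le_mul (c := t ^ 2) hk (hc t) ?_)
    filter_upwards [hck t ht] with x hx
    exact hx.trans (by gcongr; exact le_abs_self _)
  have hL : Integrable (fun x => B (a x) (b x) + B (b x) (a x)) μ := (hB ha hb).add (hB hb ha)
  have hint (t : ℝ) (ht : |t| ≤ 1) :
      ‖(∫ x, B (a x + t • b x + c t x) (a x + t • b x + c t x) ∂μ) - (∫ x, B (a x) (a x) ∂μ)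
        - t * ∫ x, (B (a x) (b x) + B (b x) (a x)) ∂μ‖ ≤ t ^ 2 * ∫ x, G x ∂μ := by
    have e : (∫ x, B (a x + t • b x + c t x) (a x + t • b x + c t x) ∂μ)
        - (∫ x, B (a x) (a x) ∂μ) - t * ∫ x, (B (a x) (b x) + B (b x) (a x)) ∂μ
        = ∫ x, (B (a x + t • b x + c t x) (a x + t • b x + c t x) - B (a x) (a x)
          - t * (B (a x) (b x) + B (b x) (a x))) ∂μ := by
      rw [integral_sub (f := fun x => B (a x + t • b x + c t x) (a x + t • b x + c t x)
          - B (a x) (a x)) ((hB (hat t ht) (hat t ht)).sub (hB ha ha)) (hL.const_mul t),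
        integral_sub (hB (hat t ht) (hat t ht)) (hB ha ha), integral_const_mul]
    rw [e, ← integral_const_mul]
    exact norm_integral_le_of_norm_le (hGi.const_mul _) (hpt t ht)
  rw [tendsto_iff_norm_sub_tendsto_zero]
  have hlim : Tendsto (fun t : ℝ => |t| * ∫ x, G x ∂μ) (𝓝[≠] 0) (𝓝 0) := by
    have : Continuous fun t : ℝ => |t| * ∫ x, G x ∂μ := by fun_prop
    simpa using (this.tendsto 0).mono_left nhdsWithin_le_nhds
  refine squeeze_zero' (Eventually.of_forall fun _ => norm_nonneg _) ?_ hlim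
  have h1 : ∀ᶠ t : ℝ in 𝓝[≠] 0, |t| ≤ 1 := by
    refine nhdsWithin_le_nhds ?_
    filter_upwards [Metric.closedBall_mem_nhds (0 : ℝ) one_pos] with t ht
    simpa using ht
  filter_upwards [h1, self_mem_nhdsWithin] with t ht ht0
  have ht0' : t ≠ 0 := ht0
  have hpos : 0 < |t| := abs_pos.2 ht0'
  have := hint t ht
  rw [← mul_le_mul_iff_right₀ hpos]
  calc |t| * _ = ‖t‖ * _ := rfl
    _ = _ := by rw [← norm_mul, mul_sub, mul_div_cancel₀ _ ht0']
    _ ≤ _ := this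
    _ = _ := by rw [← sq_abs]; ring

/-- The curl of a field on the plane in terms of its two partial derivatives. -/
def curlOf (p q : R3) : R3 := !₂[q 2, -p 2, p 1 - q 0]

/-- The bilinear form whose quadratic form, evaluated at `(m - e₃, ∂₁m, ∂₂m)`, is the energy
density. -/
def densityForm (h : ℝ) : (R3 × R3 × R3) →L[ℝ] (R3 × R3 × R3) →L[ℝ] ℝ :=
  LinearMap.toContinuousBilinearMap <| LinearMap.mk₂ ℝ
    (fun a b => (1 / 2) * (inner ℝ a.2.1 b.2.1 + inner ℝ a.2.2 b.2.2)
      + inner ℝ a.1 (curlOf b.2.1 b.2.2) + (h / 2) * inner ℝ a.1 b.1)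
    (fun a a' b => by simp only [Prod.fst_add, Prod.snd_add, inner_add_left]; ring)
    (fun c a b => by
      simp only [Prod.smul_fst, Prod.smul_snd, real_inner_smul_left, smul_eq_mul]; ring)
    (fun a b b' => by
      simp only [Prod.fst_add, Prod.snd_add, inner_add_right, curlOf, PiLp.inner_apply,
        Fin.sum_univ_three, RCLike.inner_apply, conj_trivial, PiLp.add_apply]
      simp
      ring)
    (fun c a b => by
      simp only [Prod.smul_fst, Prod.smul_snd, smul_eq_mul, curlOf,
        PiLp.inner_apply, Fin.sum_univ_three, RCLike.inner_apply, conj_trivial, PiLp.smul_apply]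
      simp
      ring)

theorem densityForm_apply (h : ℝ) (a b : R3 × R3 × R3) :
    densityForm h a b = (1 / 2) * (inner ℝ a.2.1 b.2.1 + inner ℝ a.2.2 b.2.2)
      + inner ℝ a.1 (curlOf b.2.1 b.2.2) + (h / 2) * inner ℝ a.1 b.1 := rfl

theorem energy_eq_integral_densityForm (h : ℝ) {m z p q : ℂ → R3}
    (hz : (fun x => m x - e3) =ᵐ[volume] z)
    (hp : HasWeakPartial 1 m p) (hq : HasWeakPartial Complex.I m q) :
    energy h m = ∫ x, densityForm h (z x, p x, q x) (z x, p x, q x) := by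
  refine integral_congr_ae ?_
  filter_upwards [hz, hp.weakPartial_ae_eq, hq.weakPartial_ae_eq] with x h1 h2 h3
  rw [densityForm_apply]
  simp only [curl, h2, h3, curlOf, ← h1, real_inner_self_eq_norm_sq]

/-- Used with `y = t²|φ|²`: normalising `m + tφ` costs only `O(t²)`. -/
theorem abs_inv_sqrt_one_add_sub_one_le {y : ℝ} (hy : 0 ≤ y) : |(√(1 + y))⁻¹ - 1| ≤ y := by
  have h1 : 1 ≤ √(1 + y) := by rw [Real.one_le_sqrt]; linarith
  have h2 : √(1 + y) ≤ 1 + y := by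
    rw [Real.sqrt_le_left (by linarith)]; nlinarith
  have h3 : (√(1 + y))⁻¹ ≤ 1 := inv_le_one_of_one_le₀ h1
  have h4 : (1 + y)⁻¹ ≤ (√(1 + y))⁻¹ := inv_anti₀ (by linarith) h2
  have h5 : 1 - y ≤ (1 + y)⁻¹ := by
    rw [← one_div, le_div_iff₀ (by linarith)]
    nlinarith
  rw [abs_le]
  constructor <;> linarith

theorem contDiff_inv_sqrt_one_add {p : ℂ → ℝ} (hp : ContDiff ℝ ∞ p) (hp0 : ∀ x, 0 ≤ p x) (t : ℝ) :
    ContDiff ℝ ∞ fun x => (√(1 + t ^ 2 * p x))⁻¹ - 1 := by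
  have hpos (x : ℂ) : 0 < 1 + t ^ 2 * p x := by nlinarith [mul_nonneg (sq_nonneg t) (hp0 x)]
  refine ContDiff.sub (ContDiff.inv (ContDiff.sqrt (by fun_prop) fun x => (hpos x).ne') ?_)
    contDiff_const
  exact fun x => (Real.sqrt_pos.2 (hpos x)).ne'

theorem abs_fderiv_inv_sqrt_one_add_le {p : ℂ → ℝ} (hp : ContDiff ℝ ∞ p) (hp0 : ∀ x, 0 ≤ p x)
    (t : ℝ) (x v : ℂ) :
    |fderiv ℝ (fun x => (√(1 + t ^ 2 * p x))⁻¹ - 1) x v| ≤ t ^ 2 * |fderiv ℝ p x v| := by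
  have hy : 0 ≤ t ^ 2 * p x := mul_nonneg (sq_nonneg t) (hp0 x)
  have hpos : 0 < 1 + t ^ 2 * p x := by linarith
  have h1 : 1 ≤ √(1 + t ^ 2 * p x) := by rw [Real.one_le_sqrt]; linarith
  have hd : HasFDerivAt p (fderiv ℝ p x) x :=
    ((hp.differentiable (by simp)).differentiableAt).hasFDerivAt
  have h2 := (((hd.const_mul (t ^ 2)).const_add 1).sqrt hpos.ne')
  have h3 := ((hasDerivAt_inv (by linarith : √(1 + t ^ 2 * p x) ≠ 0)).comp_hasFDerivAt x h2).sub_const 1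
  have h4 : fderiv ℝ (fun x => (√(1 + t ^ 2 * p x))⁻¹ - 1) x = _ := h3.fderiv
  rw [h4]
  simp only [smul_apply, smul_eq_mul, abs_mul, abs_neg, abs_pow]
  have e1 : |(√(1 + t ^ 2 * p x) ^ 2)⁻¹| ≤ 1 := by
    rw [abs_of_nonneg (by positivity)]
    exact inv_le_one_of_one_le₀ (one_le_pow₀ h1)
  have e2 : |1 / (2 * √(1 + t ^ 2 * p x))| ≤ 1 := by
    rw [abs_of_nonneg (by positivity), div_le_one (by positivity)]
    linarith
  rw [sq_abs]
  calc _ ≤ 1 * (1 * (t ^ 2 * |fderiv ℝ p x v|)) := by gcongr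
    _ = _ := by ring

theorem MemH1Sphere.exists_weakPartial {m : ℂ → R3} (hm : MemH1Sphere m) (v : ℂ)
    (hv : v = 1 ∨ v = Complex.I) : ∃ g, HasWeakPartial v m g ∧ MemLp g 2 volume := by
  have hconst : HasWeakPartial v (fun _ => e3) (fun _ => 0) := by
    simpa using HasWeakPartial.of_contDiff (contDiff_const (c := e3)) v
  have key : ∀ g, HasWeakPartial v (fun x => m x - e3) g ∧ MemLp g 2 volume →
      ∃ g, HasWeakPartial v m g ∧ MemLp g 2 volume := by
    rintro g ⟨hg, hg2⟩
    exact ⟨g, by simpa using hg.add hconst, hg2⟩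
  rcases hv with rfl | rfl
  · exact hm.2.2.1.elim key
  · exact hm.2.2.2.elim key

theorem isAdmissibleTangent_of_contDiff {m φ : ℂ → R3} (hφ : ContDiff ℝ ∞ φ)
    (hc : HasCompactSupport φ) (hφm : ∀ᵐ x, inner ℝ (φ x) (m x) = 0) :
    IsAdmissibleTangent m φ := by
  have hd (v : ℂ) : ∃ g, HasWeakPartial v φ g ∧ MemLp g 2 volume :=
    ⟨_, .of_contDiff hφ v, (contDiff_fderiv_apply hφ v).continuous.memLp_of_hasCompactSupport
      (hasCompactSupport_fderiv_apply hc v)⟩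
  exact ⟨hφ.continuous.memLp_of_hasCompactSupport hc,
    ⟨hφ.continuous.memLp_of_hasCompactSupport hc, hd 1, hd Complex.I⟩, hφm⟩

/-- The first variation of the energy vanishes in smooth compactly supported tangent directions. -/
theorem IsCriticalPoint.integral_densityForm_eq_zero {h : ℝ} {m : ℂ → R3}
    (hm : IsCriticalPoint h m) {g₁ g₂ : ℂ → R3} (hg₁ : HasWeakPartial 1 m g₁)
    (hg₁' : MemLp g₁ 2 volume) (hg₂ : HasWeakPartial Complex.I m g₂) (hg₂' : MemLp g₂ 2 volume)
    {φ : ℂ → R3} (hφ : ContDiff ℝ ∞ φ) (hc : HasCompactSupport φ)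
    (hφm : ∀ᵐ x, inner ℝ (φ x) (m x) = 0) :
    ∫ x, (densityForm h (m x - e3, g₁ x, g₂ x)
          (φ x, fderiv ℝ φ x 1, fderiv ℝ φ x Complex.I)
        + densityForm h (φ x, fderiv ℝ φ x 1, fderiv ℝ φ x Complex.I)
          (m x - e3, g₁ x, g₂ x)) = 0 := by
  set p : ℂ → ℝ := fun x => ‖φ x‖ ^ 2 with hp_def
  have hp : ContDiff ℝ ∞ p := hφ.norm_sq ℝ
  have hp0 (x : ℂ) : 0 ≤ p x := by positivity
  have hpc : HasCompactSupport p := hc.comp_left (g := fun y : R3 => ‖y‖ ^ 2) (by simp)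
  -- Since `φ · m = 0` and `|m| = 1`, `|m + tφ|² = 1 + t²|φ|²`. The normalising factor is therefore
  -- `1 + σ t`, smooth even though `m` is not.
  set σ : ℝ → ℂ → ℝ := fun t x => (√(1 + t ^ 2 * p x))⁻¹ - 1 with hσ_def
  have hσ (t : ℝ) : ContDiff ℝ ∞ (σ t) := contDiff_inv_sqrt_one_add hp hp0 t
  set a : ℂ → R3 × R3 × R3 := fun x => (m x - e3, g₁ x, g₂ x) with ha_def
  set b : ℂ → R3 × R3 × R3 := fun x => (φ x, fderiv ℝ φ x 1, fderiv ℝ φ x Complex.I) with hb_def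
  have hbφ (x : ℂ) : ‖φ x‖ ≤ ‖b x‖ := norm_fst_le (b x)
  have hb1 (x : ℂ) : ‖fderiv ℝ φ x 1‖ ≤ ‖b x‖ := (norm_fst_le (b x).2).trans (norm_snd_le (b x))
  have hb2 (x : ℂ) : ‖fderiv ℝ φ x Complex.I‖ ≤ ‖b x‖ :=
    (norm_snd_le (b x).2).trans (norm_snd_le (b x))
  have ha1 (x : ℂ) : ‖g₁ x‖ ≤ ‖a x‖ := (norm_fst_le (a x).2).trans (norm_snd_le (a x))
  have ha2 (x : ℂ) : ‖g₂ x‖ ≤ ‖a x‖ := (norm_snd_le (a x).2).trans (norm_snd_le (a x))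
  have hφL (v : ℂ) : MemLp (fun x => fderiv ℝ φ x v) 2 volume :=
    (contDiff_fderiv_apply hφ v).continuous.memLp_of_hasCompactSupport
      (hasCompactSupport_fderiv_apply hc v)
  have hbL : MemLp b 2 volume := memLp_prod_iff.2
    ⟨hφ.continuous.memLp_of_hasCompactSupport hc, memLp_prod_iff.2 ⟨hφL 1, hφL Complex.I⟩⟩
  have haL : MemLp a 2 volume := memLp_prod_iff.2 ⟨hm.1.2.1, memLp_prod_iff.2 ⟨hg₁', hg₂'⟩⟩
  set T : ℝ → ℂ → R3 := fun t x => m x + t • φ x with hT_def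
  -- The product rule for `σ t • (m + tφ)`: the part of the variation and of its derivatives beyond
  -- first order in `t`.
  set c : ℝ → ℂ → R3 × R3 × R3 := fun t x => (σ t x • T t x,
    fderiv ℝ (σ t) x 1 • T t x + σ t x • (g₁ x + t • fderiv ℝ φ x 1),
    fderiv ℝ (σ t) x Complex.I • T t x + σ t x • (g₂ x + t • fderiv ℝ φ x Complex.I)) with hc_def
  have hcm (t : ℝ) : AEStronglyMeasurable (c t) volume := by
    have hT : AEStronglyMeasurable (T t) volume :=
      hg₁.1.aestronglyMeasurable.add (hφ.continuous.aestronglyMeasurable.const_smul t)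
    have hs := (hσ t).continuous.aestronglyMeasurable (μ := (volume : Measure ℂ))
    have hsv (v : ℂ) := (contDiff_fderiv_apply (hσ t) v).continuous.aestronglyMeasurable
      (μ := (volume : Measure ℂ))
    have hφv (v : ℂ) := (contDiff_fderiv_apply hφ v).continuous.aestronglyMeasurable
      (μ := (volume : Measure ℂ))
    exact (hs.smul hT).prodMk ((((hsv 1).smul hT).add
      (hs.smul (hg₁'.1.add ((hφv 1).const_smul t)))).prodMk
      (((hsv Complex.I).smul hT).add (hs.smul (hg₂'.1.add ((hφv Complex.I).const_smul t)))))
  set P : ℂ → ℝ := fun x => p x + |fderiv ℝ p x 1| + |fderiv ℝ p x Complex.I| with hP_def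
  have hPc : Continuous P := (hp.continuous.add (contDiff_fderiv_apply hp 1).continuous.abs).add
    (contDiff_fderiv_apply hp Complex.I).continuous.abs
  have hPs : HasCompactSupport P :=
    (hpc.add ((hasCompactSupport_fderiv_apply hpc 1).comp_left abs_zero)).add
      ((hasCompactSupport_fderiv_apply hpc Complex.I).comp_left abs_zero)
  have hP0 (x : ℂ) : 0 ≤ P x := by
    have := hp0 x
    positivity
  obtain ⟨C, hC⟩ := hPc.bounded_above_of_compact_support hPs
  have hPC (x : ℂ) : P x ≤ C := (le_abs_self _).trans (hC x)
  -- Dominates `P (1 + ‖a‖ + 2‖b‖)`. The constant `1` is not in `L²`, so it keeps the compactly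
  -- supported factor `P`; the other terms only need `P ≤ C`.
  set k : ℂ → ℝ := fun x => P x + C * (‖a x‖ + 2 * ‖b x‖) with hk_def
  have hk : MemLp k 2 volume :=
    (hPc.memLp_of_hasCompactSupport hPs).add ((haL.norm.add (hbL.norm.const_mul 2)).const_mul C)
  have hck (t : ℝ) (ht : |t| ≤ 1) : ∀ᵐ x, ‖c t x‖ ≤ t ^ 2 * k x := by
    filter_upwards [hm.1.1] with x hx
    have hTx : ‖T t x‖ ≤ 1 + ‖b x‖ := by
      refine (norm_add_le _ _).trans (add_le_add hx.le ?_)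
      rw [norm_smul, Real.norm_eq_abs]
      nlinarith [hbφ x, norm_nonneg (φ x), abs_nonneg t]
    have hσx : |σ t x| ≤ t ^ 2 * P x := by
      refine (abs_inv_sqrt_one_add_sub_one_le (by have := hp0 x; positivity)).trans ?_
      gcongr
      have h1 := abs_nonneg (fderiv ℝ p x 1)
      have h2 := abs_nonneg (fderiv ℝ p x Complex.I)
      simp only [hP_def]
      linarith
    have hkx : P x * (1 + ‖a x‖ + 2 * ‖b x‖) ≤ k x := by
      have := mul_le_mul_of_nonneg_right (hPC x)
        (by positivity : 0 ≤ ‖a x‖ + 2 * ‖b x‖)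
      simp only [hk_def]
      linarith
    have hder (v : ℂ) (g : R3) (hv : |fderiv ℝ p x v| + p x ≤ P x) (hg : ‖g‖ ≤ ‖a x‖)
        (hφv : ‖fderiv ℝ φ x v‖ ≤ ‖b x‖) :
        ‖fderiv ℝ (σ t) x v • T t x + σ t x • (g + t • fderiv ℝ φ x v)‖ ≤ t ^ 2 * k x := by
      have hs1 : |fderiv ℝ (σ t) x v| ≤ t ^ 2 * |fderiv ℝ p x v| :=
        abs_fderiv_inv_sqrt_one_add_le hp hp0 t x v
      have hs2 : |σ t x| ≤ t ^ 2 * p x :=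
        abs_inv_sqrt_one_add_sub_one_le (by have := hp0 x; positivity)
      have hgt : ‖g + t • fderiv ℝ φ x v‖ ≤ ‖a x‖ + ‖b x‖ := by
        refine (norm_add_le _ _).trans (add_le_add hg ?_)
        rw [norm_smul, Real.norm_eq_abs]
        nlinarith [norm_nonneg (fderiv ℝ φ x v), abs_nonneg t]
      calc _ ≤ |fderiv ℝ (σ t) x v| * ‖T t x‖ + |σ t x| * ‖g + t • fderiv ℝ φ x v‖ := by
            refine (norm_add_le _ _).trans_eq ?_
            rw [norm_smul, norm_smul, Real.norm_eq_abs, Real.norm_eq_abs]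
        _ ≤ t ^ 2 * |fderiv ℝ p x v| * (1 + ‖a x‖ + 2 * ‖b x‖)
            + t ^ 2 * p x * (1 + ‖a x‖ + 2 * ‖b x‖) := by
            have := hp0 x
            gcongr
            · linarith [norm_nonneg (a x), norm_nonneg (b x)]
            · linarith [norm_nonneg (a x), norm_nonneg (b x)]
        _ = t ^ 2 * ((|fderiv ℝ p x v| + p x) * (1 + ‖a x‖ + 2 * ‖b x‖)) := by ring
        _ ≤ t ^ 2 * (P x * (1 + ‖a x‖ + 2 * ‖b x‖)) := by gcongr
        _ ≤ _ := by gcongr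
    have h1 := abs_nonneg (fderiv ℝ p x 1)
    have h2 := abs_nonneg (fderiv ℝ p x Complex.I)
    refine norm_prod_le_iff.2 ⟨?_, norm_prod_le_iff.2 ⟨?_, ?_⟩⟩
    · calc ‖σ t x • T t x‖ = |σ t x| * ‖T t x‖ := by rw [norm_smul, Real.norm_eq_abs]
        _ ≤ t ^ 2 * P x * (1 + ‖a x‖ + 2 * ‖b x‖) := by
            have := hP0 x
            gcongr
            linarith [norm_nonneg (a x), norm_nonneg (b x)]
        _ = t ^ 2 * (P x * (1 + ‖a x‖ + 2 * ‖b x‖)) := by ring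
        _ ≤ _ := by gcongr
    · exact hder 1 _ (by simp only [hP_def]; linarith) (ha1 x) (hb1 x)
    · exact hder Complex.I _ (by simp only [hP_def]; linarith) (ha2 x) (hb2 x)
  have hvar (t : ℝ) : variation m φ t =ᵐ[volume] fun x => m x + t • φ x + σ t x • T t x := by
    filter_upwards [hm.1.1, hφm] with x hx hx'
    have e : ‖m x + t • φ x‖ = √(1 + t ^ 2 * p x) := by
      rw [eq_comm, Real.sqrt_eq_iff_eq_sq (by have := hp0 x; positivity) (norm_nonneg _),
        norm_add_sq_real, real_inner_smul_right, real_inner_comm, hx', hx, norm_smul, mul_pow,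
        Real.norm_eq_abs, sq_abs]
      ring
    simp only [variation, e, hσ_def, hT_def, sub_smul, one_smul]
    abel
  have hwv (t : ℝ) (v : ℂ) (g : ℂ → R3) (hg : HasWeakPartial v m g) :
      HasWeakPartial v (variation m φ t) (fun x => g x + t • fderiv ℝ φ x v +
        (fderiv ℝ (σ t) x v • T t x + σ t x • (g x + t • fderiv ℝ φ x v))) := by
    have hT : HasWeakPartial v (T t) (fun x => g x + t • fderiv ℝ φ x v) := by
      refine hg.add ?_
      have := HasWeakPartial.of_contDiff (hφ.const_smul t) v
      convert this using 2 with x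
      rw [fderiv_fun_const_smul ((hφ.differentiable (by simp)).differentiableAt)]
      rfl
    exact (hT.add (hT.contDiff_smul (hσ t))).congr_ae (hvar t).symm
  have hE (t : ℝ) : energy h (variation m φ t)
      = ∫ x, densityForm h (a x + t • b x + c t x) (a x + t • b x + c t x) := by
    refine energy_eq_integral_densityForm h ?_ (hwv t 1 g₁ hg₁) (hwv t Complex.I g₂ hg₂)
    filter_upwards [hvar t] with x hx
    change variation m φ t x - e3 = m x - e3 + t • φ x + σ t x • T t x
    rw [hx]
    abel
  have hE0 : energy h m = ∫ x, densityForm h (a x) (a x) :=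
    energy_eq_integral_densityForm h EventuallyEq.rfl hg₁ hg₂
  have hlim := tendsto_quadratic_difference_quotient (densityForm h) haL hbL hcm hk hck
  have hlim' := hm.2 φ (isAdmissibleTangent_of_contDiff hφ hc hφm)
  simp only [hE, hE0] at hlim'
  exact tendsto_nhds_unique hlim hlim'

/-! ### Planar test fields and the Euler–Lagrange equation -/

/-- The inclusion of the plane into `ℝ³`. -/
def planar : ℂ →L[ℝ] R3 := LinearMap.toContinuousLinearMap
  { toFun := fun z => !₂[z.re, z.im, 0]
    map_add' := fun z w => by ext i; fin_cases i <;> simp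
    map_smul' := fun c z => by ext i; fin_cases i <;> simp }

@[simp] theorem planar_apply_zero (z : ℂ) : planar z 0 = z.re := rfl
@[simp] theorem planar_apply_one (z : ℂ) : planar z 1 = z.im := rfl
@[simp] theorem planar_apply_two (z : ℂ) : planar z 2 = 0 := rfl

theorem inner_planar (y : R3) (z : ℂ) : inner ℝ y (planar z) = y 0 * z.re + y 1 * z.im := by
  simp [PiLp.inner_apply, Fin.sum_univ_three, mul_comm]

theorem fderiv_planar_comp {Φ : ℂ → ℂ} (hΦ : ContDiff ℝ ∞ Φ) (x v : ℂ) :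
    fderiv ℝ (fun x => planar (Φ x)) x v = planar (fderiv ℝ Φ x v) := by
  have := planar.hasFDerivAt.comp x
    ((hΦ.differentiable (by simp)).differentiableAt (x := x)).hasFDerivAt
  exact congrArg (fun T : ℂ →L[ℝ] R3 => T v) this.fderiv

theorem integrable_inner_planar {g : ℂ → R3} (hg : LocallyIntegrable g) {Φ : ℂ → ℂ}
    (hΦ : Continuous Φ) (hc : HasCompactSupport Φ) :
    Integrable fun x => inner ℝ (g x) (planar (Φ x)) := by
  simp only [inner_planar]
  refine Integrable.add ?_ ?_
  · simpa only [smul_eq_mul, mul_comm] using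
      integrable_test_smul (ζ := fun x => (Φ x).re) (Complex.continuous_re.comp hΦ)
        (hc.comp_left (g := Complex.re) rfl) (locallyIntegrable_apply hg 0)
  · simpa only [smul_eq_mul, mul_comm] using
      integrable_test_smul (ζ := fun x => (Φ x).im) (Complex.continuous_im.comp hΦ)
        (hc.comp_left (g := Complex.im) rfl) (locallyIntegrable_apply hg 1)

theorem fderiv_re_apply {Φ : ℂ → ℂ} (hΦ : ContDiff ℝ ∞ Φ) (x v : ℂ) :
    fderiv ℝ (fun x => (Φ x).re) x v = (fderiv ℝ Φ x v).re := by
  have := Complex.reCLM.hasFDerivAt.comp x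
    ((hΦ.differentiable (by simp)).differentiableAt (x := x)).hasFDerivAt
  exact congrArg (fun T : ℂ →L[ℝ] ℝ => T v) this.fderiv

theorem fderiv_im_apply {Φ : ℂ → ℂ} (hΦ : ContDiff ℝ ∞ Φ) (x v : ℂ) :
    fderiv ℝ (fun x => (Φ x).im) x v = (fderiv ℝ Φ x v).im := by
  have := Complex.imCLM.hasFDerivAt.comp x
    ((hΦ.differentiable (by simp)).differentiableAt (x := x)).hasFDerivAt
  exact congrArg (fun T : ℂ →L[ℝ] ℝ => T v) this.fderiv

/-- The Laplacian of a map between planes, as an iterated directional derivative. -/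
def planeLaplacian (Φ : ℂ → ℂ) (x : ℂ) : ℂ :=
  fderiv ℝ (fun y => fderiv ℝ Φ y 1) x 1
    + fderiv ℝ (fun y => fderiv ℝ Φ y Complex.I) x Complex.I

/-- The scalar curl of a planar field. -/
def planeCurl (Φ : ℂ → ℂ) (x : ℂ) : ℝ := (fderiv ℝ Φ x 1).im - (fderiv ℝ Φ x Complex.I).re

theorem continuous_planeCurl {Φ : ℂ → ℂ} (hΦ : ContDiff ℝ ∞ Φ) : Continuous (planeCurl Φ) :=
  (Complex.continuous_im.comp (contDiff_fderiv_apply hΦ 1).continuous).sub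
    (Complex.continuous_re.comp (contDiff_fderiv_apply hΦ Complex.I).continuous)

theorem hasCompactSupport_planeCurl {Φ : ℂ → ℂ} (hc : HasCompactSupport Φ) :
    HasCompactSupport (planeCurl Φ) :=
  ((hasCompactSupport_fderiv_apply hc 1).comp_left (g := Complex.im) rfl).sub
    ((hasCompactSupport_fderiv_apply hc Complex.I).comp_left (g := Complex.re) rfl)

/-- The Euler–Lagrange equation of a critical point tested with planar tangent fields. -/
theorem IsCriticalPoint.integral_planar {h : ℝ} {m : ℂ → R3} (hm : IsCriticalPoint h m)
    {Φ : ℂ → ℂ} (hΦ : ContDiff ℝ ∞ Φ) (hc : HasCompactSupport Φ)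
    (hΦm : ∀ᵐ x, inner ℝ (m x) (planar (Φ x)) = 0) :
    2 * ∫ x, planeCurl Φ x * (m x 2 - 1) = ∫ x, inner ℝ (m x) (planar (planeLaplacian Φ x)) := by
  obtain ⟨g₁, hg₁, hg₁'⟩ := hm.1.exists_weakPartial 1 (.inl rfl)
  obtain ⟨g₂, hg₂, hg₂'⟩ := hm.1.exists_weakPartial Complex.I (.inr rfl)
  have hφ : ContDiff ℝ ∞ fun x => planar (Φ x) := planar.contDiff.comp hΦ
  have hφc : HasCompactSupport fun x => planar (Φ x) := hc.comp_left (map_zero planar)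
  have key := hm.integral_densityForm_eq_zero hg₁ hg₁' hg₂ hg₂' hφ hφc
    (by simpa only [real_inner_comm] using hΦm)
  have hconst (v : ℂ) : HasWeakPartial v (fun _ => -e3) (fun _ => 0) := by
    simpa using HasWeakPartial.of_contDiff (contDiff_const (c := -e3)) v
  have hu (v : ℂ) (g : ℂ → R3) (hg : HasWeakPartial v m g) :
      HasWeakPartial v (fun x => m x - e3) g := by
    simpa [sub_eq_add_neg] using hg.add (hconst v)
  have hu₁ := hu _ _ hg₁
  have hu₂ := hu _ _ hg₂
  have hΦd (v : ℂ) := contDiff_fderiv_apply hΦ v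
  have hΦdc (v : ℂ) := hasCompactSupport_fderiv_apply hc v
  have hre : ContDiff ℝ ∞ fun x => (Φ x).re := Complex.reCLM.contDiff.comp hΦ
  have him : ContDiff ℝ ∞ fun x => (Φ x).im := Complex.imCLM.contDiff.comp hΦ
  have hrec : HasCompactSupport fun x => (Φ x).re := hc.comp_left (g := Complex.re) rfl
  have himc : HasCompactSupport fun x => (Φ x).im := hc.comp_left (g := Complex.im) rfl
  -- A second integration by parts; `m - e₃` may be replaced by `m` because `e₃` is orthogonal to
  -- the plane.
  have hd (v : ℂ) (g : ℂ → R3) (hg : HasWeakPartial v (fun x => m x - e3) g) :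
      ∫ x, inner ℝ (g x) (planar (fderiv ℝ Φ x v))
        = -∫ x, inner ℝ (m x) (planar (fderiv ℝ (fun y => fderiv ℝ Φ y v) x v)) := by
    have := hg.integral_inner_fderiv (φ := fun x => planar (fderiv ℝ Φ x v))
      (planar.contDiff.comp (hΦd v)) ((hΦdc v).comp_left (map_zero planar))
    rw [eq_neg_iff_add_eq_zero, add_comm, ← eq_neg_iff_add_eq_zero, ← this]
    refine integral_congr_ae (Eventually.of_forall fun x => ?_)
    simp only [fderiv_planar_comp (hΦd v), inner_planar]
    simp [e3]
  -- Integrated by parts, `φ · curl m` contributes the same integral as `(m - e₃) · curl φ`, whence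
  -- the factor `2`.
  have hre' := hu₂.integral_fderiv_mul_apply hre hrec 2
  have him' := hu₁.integral_fderiv_mul_apply him himc 2
  simp only [fderiv_re_apply hΦ, fderiv_im_apply hΦ] at hre' him'
  have e32 : e3 2 = 1 := by simp [e3]
  simp only [PiLp.sub_apply, e32] at hre' him'
  have hli : LocallyIntegrable fun x => m x 2 - 1 := by
    simpa [e32] using locallyIntegrable_apply hu₁.1 2
  have i1 := integrable_inner_planar hg₁.2.1 (hΦd 1).continuous (hΦdc 1)
  have i2 := integrable_inner_planar hg₂.2.1 (hΦd Complex.I).continuous (hΦdc Complex.I)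
  have i3 : Integrable fun x => planeCurl Φ x * (m x 2 - 1) :=
    integrable_test_smul (continuous_planeCurl hΦ) (hasCompactSupport_planeCurl hc) hli
  have i4 : Integrable fun x => (Φ x).re * g₂ x 2 :=
    integrable_test_smul hre.continuous hrec (locallyIntegrable_apply hg₂.2.1 2)
  have i5 : Integrable fun x => (Φ x).im * g₁ x 2 :=
    integrable_test_smul him.continuous himc (locallyIntegrable_apply hg₁.2.1 2)
  have i6 : Integrable fun x => (fderiv ℝ Φ x 1).im * (m x 2 - 1) :=
    integrable_test_smul (Complex.continuous_im.comp (hΦd 1).continuous)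
      ((hΦdc 1).comp_left (g := Complex.im) rfl) hli
  have i7 : Integrable fun x => (fderiv ℝ Φ x Complex.I).re * (m x 2 - 1) :=
    integrable_test_smul (Complex.continuous_re.comp (hΦd Complex.I).continuous)
      ((hΦdc Complex.I).comp_left (g := Complex.re) rfl) hli
  have hcurl : ∫ x, planeCurl Φ x * (m x 2 - 1)
      = (∫ x, (fderiv ℝ Φ x 1).im * (m x 2 - 1))
        - ∫ x, (fderiv ℝ Φ x Complex.I).re * (m x 2 - 1) := by
    rw [← integral_sub i6 i7]
    simp only [planeCurl, sub_mul]
  have hsplit : ∫ x, (inner ℝ (g₁ x) (planar (fderiv ℝ Φ x 1))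
      + inner ℝ (g₂ x) (planar (fderiv ℝ Φ x Complex.I)) + planeCurl Φ x * (m x 2 - 1)
      + ((Φ x).re * g₂ x 2 - (Φ x).im * g₁ x 2)) = 0 := by
    rw [← key]
    refine integral_congr_ae ?_
    filter_upwards [hΦm] with x hx
    simp only [densityForm_apply, fderiv_planar_comp hΦ]
    -- `Φ` is orthogonal to both `m` and `e₃`, so the term with `h` disappears.
    have hx' : inner ℝ (m x - e3) (planar (Φ x)) = 0 := by
      rw [inner_sub_left, hx, inner_planar]
      simp [e3]
    rw [real_inner_comm (g₁ x), real_inner_comm (g₂ x), real_inner_comm (m x - e3), hx']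
    simp [curlOf, PiLp.inner_apply, Fin.sum_univ_three, planeCurl, e3]
    ring
  have i12 : Integrable fun x => inner ℝ (g₁ x) (planar (fderiv ℝ Φ x 1))
      + inner ℝ (g₂ x) (planar (fderiv ℝ Φ x Complex.I)) := i1.add i2
  have i123 : Integrable fun x => inner ℝ (g₁ x) (planar (fderiv ℝ Φ x 1))
      + inner ℝ (g₂ x) (planar (fderiv ℝ Φ x Complex.I)) + planeCurl Φ x * (m x 2 - 1) :=
    i12.add i3
  have i45 : Integrable fun x => (Φ x).re * g₂ x 2 - (Φ x).im * g₁ x 2 := i4.sub i5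
  rw [integral_add i123 i45, integral_add i12 i3,
    integral_add i1 i2, integral_sub i4 i5, hd 1 g₁ hu₁, hd Complex.I g₂ hu₂] at hsplit
  have hΔ (v : ℂ) := integrable_inner_planar hg₁.1
    (contDiff_fderiv_apply (hΦd v) v).continuous (hasCompactSupport_fderiv_apply (hΦdc v) v)
  have hlap : ∫ x, inner ℝ (m x) (planar (planeLaplacian Φ x))
      = (∫ x, inner ℝ (m x) (planar (fderiv ℝ (fun y => fderiv ℝ Φ y 1) x 1)))
        + ∫ x, inner ℝ (m x)
          (planar (fderiv ℝ (fun y => fderiv ℝ Φ y Complex.I) x Complex.I)) := by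
    rw [← integral_add (hΔ 1) (hΔ Complex.I)]
    simp only [planeLaplacian, map_add, inner_add_right]
  linarith

/-! ### Behaviour under rotations -/

theorem integral_comp_rotation {F : Type*} [NormedAddCommGroup F] [NormedSpace ℝ F] (f : ℂ → F)
    {a : ℂ} (ha : ‖a‖ = 1) : ∫ x, f (a * x) = ∫ x, f x := by
  let e := rotation (⟨a, mem_sphere_zero_iff_norm.2 ha⟩ : Circle)
  exact e.measurePreserving.integral_comp e.toHomeomorph.measurableEmbedding f

theorem integral_eq_zero_of_rotation_neg {f : ℂ → ℝ} {a : ℂ} (ha : ‖a‖ = 1)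
    (hf : ∀ x, f (a * x) = -f x) : ∫ x, f x = 0 := by
  have := integral_comp_rotation f ha
  simp only [hf, integral_neg] at this
  linarith

theorem fderiv_rotation {Φ Ψ : ℂ → ℂ} (hΦ : Differentiable ℝ Φ) (hΨ : Differentiable ℝ Ψ)
    {a c : ℂ} (h : ∀ x, Ψ (a * x) = c * Φ x) (x v : ℂ) :
    fderiv ℝ Ψ (a * x) (a * v) = c * fderiv ℝ Φ x v := by
  have h1 : HasFDerivAt (fun x => Ψ (a * x)) _ x :=
    (hΨ (a * x)).hasFDerivAt.comp x ((hasFDerivAt_id x).const_mul a)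
  have h2 : HasFDerivAt (fun x => c * Φ x) _ x := (hΦ x).hasFDerivAt.const_mul c
  simp only [h] at h1
  simpa using congrArg (fun T : ℂ →L[ℝ] ℂ => T v) (h1.unique h2)

theorem fderiv_apply_eq (T : ℂ →L[ℝ] ℂ) (v : ℂ) : T v = v.re * T 1 + v.im * T Complex.I := by
  conv_lhs => rw [show v = v.re • (1 : ℂ) + v.im • Complex.I by simp [Complex.re_add_im]]
  rw [map_add, map_smul, map_smul, Complex.real_smul, Complex.real_smul]

theorem re_sq_add_im_sq_of_norm_eq_one {a : ℂ} (ha : ‖a‖ = 1) : (a.re : ℂ) ^ 2 + (a.im : ℂ) ^ 2 = 1 := by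
  have := Complex.normSq_eq_norm_sq a
  rw [ha, Complex.normSq_apply] at this
  norm_cast
  linarith

/-- The Laplacian is a trace, so it can be computed in the rotated orthonormal basis `a`, `a i`. -/
theorem planeLaplacian_rotation {Φ : ℂ → ℂ} (hΦ : ContDiff ℝ ∞ Φ) {a c : ℂ} (ha : ‖a‖ = 1)
    (h : ∀ x, Φ (a * x) = c * Φ x) (x : ℂ) :
    planeLaplacian Φ (a * x) = c * planeLaplacian Φ x := by
  have hd := hΦ.differentiable (by simp)
  have hdd (v : ℂ) := (contDiff_fderiv_apply hΦ v).differentiable (by simp)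
  have key (v : ℂ) := fderiv_rotation (hdd v) (hdd (a * v))
    (fun y => fderiv_rotation hd hd h y v) x v
  have hlin (v : ℂ) : (fun y => fderiv ℝ Φ y v)
      = fun y => v.re * fderiv ℝ Φ y 1 + v.im * fderiv ℝ Φ y Complex.I := by
    funext y
    exact fderiv_apply_eq _ v
  have hsec (v : ℂ) (y : ℂ) (w : ℂ) : fderiv ℝ (fun y => fderiv ℝ Φ y v) y w
      = v.re * fderiv ℝ (fun y => fderiv ℝ Φ y 1) y w
        + v.im * fderiv ℝ (fun y => fderiv ℝ Φ y Complex.I) y w := by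
    have hs : HasFDerivAt (fun y => v.re * fderiv ℝ Φ y 1 + v.im * fderiv ℝ Φ y Complex.I) _ y :=
      ((hdd 1 y).hasFDerivAt.const_mul (v.re : ℂ)).add
        ((hdd Complex.I y).hasFDerivAt.const_mul (v.im : ℂ))
    rw [hlin v, hs.fderiv]
    simp
  have hbil (v w : ℂ) (y : ℂ) := fderiv_apply_eq (fderiv ℝ (fun y => fderiv ℝ Φ y v) y) w
  have k1 := key 1
  have k2 := key Complex.I
  rw [hsec, hbil 1, hbil Complex.I] at k1 k2
  simp only [mul_one, Complex.mul_re, Complex.mul_im, Complex.I_re, Complex.I_im, mul_zero,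
    zero_sub, add_zero, Complex.ofReal_neg] at k1 k2
  rw [planeLaplacian, planeLaplacian, mul_add, ← k1, ← k2]
  linear_combination (-(fderiv ℝ (fun y => fderiv ℝ Φ y 1) (a * x) 1)
    - fderiv ℝ (fun y => fderiv ℝ Φ y Complex.I) (a * x) Complex.I) * re_sq_add_im_sq_of_norm_eq_one ha

/-- The curl is the imaginary part of `∂₁Φ - i ∂₂Φ`, twice the Wirtinger derivative `∂_z Φ`.
Differentiating the hypothesis in `z` gives `a ∂_z Φ(a x) = -a ∂_z Φ(x)`, and `a` cancels. -/
theorem planeCurl_rotation_neg {Φ : ℂ → ℂ} (hΦ : ContDiff ℝ ∞ Φ) {a : ℂ} (ha : ‖a‖ = 1)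
    (h : ∀ x, Φ (a * x) = -a * Φ x) (x : ℂ) : planeCurl Φ (a * x) = -planeCurl Φ x := by
  have hd := hΦ.differentiable (by simp)
  have e (y : ℂ) : planeCurl Φ y
      = (fderiv ℝ Φ y 1 - Complex.I * fderiv ℝ Φ y Complex.I).im := by simp [planeCurl]
  have k1 := fderiv_rotation hd hd h x 1
  have k2 := fderiv_rotation hd hd h x Complex.I
  rw [fderiv_apply_eq] at k1 k2
  simp only [mul_one, Complex.mul_re, Complex.mul_im, Complex.I_re, Complex.I_im, mul_zero,
    zero_sub, add_zero, Complex.ofReal_neg] at k1 k2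
  rw [e, e, ← Complex.neg_im]
  congr 1
  have ha0 : a ≠ 0 := by rintro rfl; simp at ha
  apply mul_left_cancel₀ ha0
  have hre : a = a.re + a.im * Complex.I := (Complex.re_add_im a).symm
  linear_combination k1 - Complex.I * k2
    + (fderiv ℝ Φ (a * x) 1 - Complex.I * fderiv ℝ Φ (a * x) Complex.I) * hre
    - a.im * fderiv ℝ Φ (a * x) Complex.I * Complex.I_sq

theorem exists_norm_eq_one_zpow_eq_neg_one {n : ℤ} (hn : n ≠ 0) :
    ∃ a : ℂ, ‖a‖ = 1 ∧ a ^ n = -1 := by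
  have hn' : (n : ℂ) ≠ 0 := by exact_mod_cast hn
  refine ⟨Complex.exp ((Real.pi / n : ℝ) * Complex.I), Complex.norm_exp_ofReal_mul_I _, ?_⟩
  rw [← Complex.exp_int_mul, ← Complex.exp_pi_mul_I]
  congr 1
  push_cast
  field_simp

/-! ### Axisymmetric fields and radial cutoffs -/

/-- The planar part `m₁ + i m₂`. -/
def planePart (y : R3) : ℂ := ⟨y 0, y 1⟩

theorem inner_planar_eq_re (y : R3) (z : ℂ) :
    inner ℝ y (planar z) = (starRingEnd ℂ (planePart y) * z).re := by
  rw [inner_planar]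
  simp [planePart]

theorem IsAxisymmetric.planePart_eq {N : ℤ} {γ : ℝ} {m : ℂ → R3} (hm : IsAxisymmetric N γ m) :
    ∃ S C : ℝ → ℝ, (∀ x ≠ 0, planePart (m x) = S ‖x‖ * Complex.exp (γ * Complex.I) * x ^ (-N)) ∧
      ∀ x ≠ 0, m x 2 = C ‖x‖ := by
  obtain ⟨θ, hθ⟩ := hm
  -- The factor `r ^ N` compensates `|x ^ (-N)| = r ^ (-N)`.
  refine ⟨fun r => Real.sin (θ r) * r ^ N, fun r => Real.cos (θ r), fun x hx => ?_, fun x hx => ?_⟩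
  · have hr : 0 < ‖x‖ := norm_pos_iff.2 hx
    have hx' : (‖x‖ : ℂ) * Complex.exp (Complex.I * x.arg) = x := by
      rw [mul_comm Complex.I]; exact Complex.norm_mul_exp_arg_mul_I x
    have h1 := hθ ‖x‖ hr x.arg
    rw [hx'] at h1
    have hr' : (‖x‖ : ℂ) ≠ 0 := by exact_mod_cast hr.ne'
    have e1 : x ^ (-N) = (‖x‖ : ℂ) ^ (-N) * Complex.exp (-(N * x.arg : ℝ) * Complex.I) := by
      conv_lhs => rw [← hx']
      rw [mul_zpow, ← Complex.exp_int_mul]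
      congr 2
      push_cast
      ring
    have e2 : planePart (m x)
        = Real.sin (θ ‖x‖) * Complex.exp ((γ - N * x.arg : ℝ) * Complex.I) := by
      rw [Complex.exp_mul_I, ← Complex.ofReal_cos, ← Complex.ofReal_sin, h1]
      apply Complex.ext <;> simp [planePart, -Complex.ofReal_cos, -Complex.ofReal_sin] <;> ring
    rw [e2, e1]
    have e3 : Complex.exp ((γ - N * x.arg : ℝ) * Complex.I)
        = Complex.exp (γ * Complex.I) * Complex.exp (-(N * x.arg : ℝ) * Complex.I) := by
      rw [← Complex.exp_add]
      congr 1
      push_cast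
      ring
    rw [e3, zpow_neg]
    push_cast
    field_simp
  · have hr : 0 < ‖x‖ := norm_pos_iff.2 hx
    have h1 := hθ ‖x‖ hr x.arg
    rw [mul_comm Complex.I, Complex.norm_mul_exp_arg_mul_I] at h1
    rw [h1]
    simp

theorem contDiffAt_zpow (n : ℤ) {x : ℂ} (hx : x ≠ 0) : ContDiffAt ℝ ∞ (fun y : ℂ => y ^ n) x :=
  ((analyticAt_id.zpow hx).contDiffAt (𝕜 := ℂ)).restrict_scalars ℝ

/-- The cutoff vanishes near the origin, the only place where `F` may be singular. -/
theorem contDiff_radial_cutoff_mul {W : ℝ → ℝ} (hW : ContDiff ℝ ∞ W) {ε : ℝ} (hε : 0 < ε)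
    (hW0 : ∀ s ≤ ε, W s = 0) {F : ℂ → ℂ} (hF : ∀ x ≠ 0, ContDiffAt ℝ ∞ F x) :
    ContDiff ℝ ∞ fun x : ℂ => (W (‖x‖ ^ 2) : ℂ) * F x := by
  rw [contDiff_iff_contDiffAt]
  intro x
  by_cases hx : x = 0
  · have : (fun x : ℂ => (W (‖x‖ ^ 2) : ℂ) * F x) =ᶠ[𝓝 x] fun _ => 0 := by
      have hc : ContinuousAt (fun y : ℂ => ‖y‖ ^ 2) x := by fun_prop
      have h0 : ‖x‖ ^ 2 < ε := by simpa [hx] using hε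
      filter_upwards [hc.eventually (gt_mem_nhds h0)] with y hy
      simp [hW0 _ hy.le]
    exact contDiffAt_const.congr_of_eventuallyEq this
  · exact (Complex.ofRealCLM.contDiff.comp (hW.comp (contDiff_norm_sq ℝ))).contDiffAt.mul (hF x hx)

theorem hasCompactSupport_radial_cutoff_mul {W : ℝ → ℝ} {K : ℝ} (hWK : ∀ s, K ≤ s → W s = 0)
    (F : ℂ → ℂ) : HasCompactSupport fun x : ℂ => (W (‖x‖ ^ 2) : ℂ) * F x := by
  refine HasCompactSupport.intro (isCompact_closedBall (0 : ℂ) √K) fun x hx => ?_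
  have hx' : √K < ‖x‖ := by simpa using hx
  rw [hWK _ (Real.lt_sq_of_sqrt_lt hx').le]
  simp

/-- The value is twice the derivative of `s W(s)` at `s = ‖x‖²`. -/
theorem planeCurl_radial {W : ℝ → ℝ} (hW : ContDiff ℝ ∞ W) (x : ℂ) :
    planeCurl (fun x : ℂ => (W (‖x‖ ^ 2) : ℂ) * (Complex.I * x)) x
      = 2 * W (‖x‖ ^ 2) + 2 * (‖x‖ ^ 2 * deriv W (‖x‖ ^ 2)) := by
  have h1 : HasFDerivAt (fun x : ℂ => W (‖x‖ ^ 2)) _ x :=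
    ((hW.differentiable (by simp)) (‖x‖ ^ 2)).hasDerivAt.comp_hasFDerivAt x
      (hasStrictFDerivAt_norm_sq x).hasFDerivAt
  have h2 : HasFDerivAt (fun x : ℂ => (W (‖x‖ ^ 2) : ℂ)) _ x :=
    Complex.ofRealCLM.hasFDerivAt.comp x h1
  have h3 : HasFDerivAt (fun x : ℂ => (W (‖x‖ ^ 2) : ℂ) * (Complex.I * x)) _ x :=
    h2.mul ((hasFDerivAt_id x).const_mul Complex.I)
  rw [planeCurl, h3.fderiv]
  have hq : ‖x‖ ^ 2 = x.re * x.re + x.im * x.im := by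
    rw [← Complex.normSq_eq_norm_sq, Complex.normSq_apply]
  simp [Complex.inner]
  rw [hq]
  ring

/-- On the unit sphere `|m - e₃|² = 2 - 2 m₃`. -/
theorem integrable_apply_two_sub_one {m : ℂ → R3} (hm : MemH1Sphere m) :
    Integrable fun x => m x 2 - 1 := by
  refine ((hm.2.1.integrable_norm_pow (by simp)).const_mul (-(1 / 2))).congr ?_
  filter_upwards [hm.1] with x hx
  have h1 : inner ℝ (m x) e3 = m x 2 := by
    simp [e3, PiLp.inner_apply, Fin.sum_univ_three]
  have h2 : ‖e3‖ ^ 2 = 1 := by simp [e3, EuclideanSpace.norm_sq_eq, Fin.sum_univ_three]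
  have h3 := norm_sub_sq_real (m x) e3
  rw [hx, h1, h2] at h3
  change -(1 / 2) * ‖m x - e3‖ ^ 2 = m x 2 - 1
  rw [h3]
  ring

theorem eq_e3_of_norm_of_apply_two {y : R3} (hy : ‖y‖ = 1) (h2 : y 2 = 1) : y = e3 := by
  have h := EuclideanSpace.norm_sq_eq y
  rw [hy, Fin.sum_univ_three, h2] at h
  simp only [Real.norm_eq_abs, sq_abs] at h
  have h0 : y 0 = 0 := by nlinarith [sq_nonneg (y 0), sq_nonneg (y 1)]
  have h1 : y 1 = 0 := by nlinarith [sq_nonneg (y 0), sq_nonneg (y 1)]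
  ext i
  fin_cases i <;> simp [e3, h0, h1, h2]

theorem star_eq_inv_of_norm_eq_one {a : ℂ} (ha : ‖a‖ = 1) : starRingEnd ℂ a = a⁻¹ := by
  rw [Complex.inv_def, Complex.normSq_eq_norm_sq, ha]
  simp

/-! ### The radial identity -/

/-- For winding number `N ≠ -1`, the third component of an axisymmetric critical point is
weakly constant in the radial direction. -/
theorem integral_radial_eq_zero {h : ℝ} {N : ℤ} (hN : N ≠ -1) {γ : ℝ} {m : ℂ → R3}
    (hm : IsCriticalPoint h m) (hax : IsAxisymmetric N γ m) {W : ℝ → ℝ} (hW : ContDiff ℝ ∞ W)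
    {ε K : ℝ} (hε : 0 < ε) (hW0 : ∀ s ≤ ε, W s = 0) (hWK : ∀ s, K ≤ s → W s = 0) :
    ∫ x, (2 * W (‖x‖ ^ 2) + 2 * (‖x‖ ^ 2 * deriv W (‖x‖ ^ 2))) * (m x 2 - 1) = 0 := by
  obtain ⟨S, C, hS, hC⟩ := hax.planePart_eq
  have hN1 : N + 1 ≠ 0 := fun h => hN (by omega)
  set e : ℂ := Complex.exp (γ * Complex.I) with he_def
  have he0 : e ≠ 0 := Complex.exp_ne_zero _
  have he : starRingEnd ℂ e = e⁻¹ :=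
    star_eq_inv_of_norm_eq_one (Complex.norm_exp_ofReal_mul_I γ)
  -- The multiple of `W` which, added to `W i x`, makes the sum tangent: with `n = e (x/|x|)^{-N}`
  -- it equals `i n² x̄`, and `i x + i n² x̄ = 2 Re(n x̄) i n`.
  set F₁ : ℂ → ℂ := fun x => Complex.I * e ^ 2 * (starRingEnd ℂ x ^ (N + 1) * x ^ (-N)) with hF₁
  set Φ₁ : ℂ → ℂ := fun x => (W (‖x‖ ^ 2) : ℂ) * F₁ x with hΦ₁_def
  set Φ₂ : ℂ → ℂ := fun x => (W (‖x‖ ^ 2) : ℂ) * (Complex.I * x) with hΦ₂_def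
  have hΦ₁ : ContDiff ℝ ∞ Φ₁ := by
    refine contDiff_radial_cutoff_mul hW hε hW0 fun x hx => ?_
    have hx' : starRingEnd ℂ x ≠ 0 := by simpa using hx
    exact contDiffAt_const.mul (((contDiffAt_zpow (N + 1) hx').comp x
      Complex.conjCLE.contDiff.contDiffAt).mul (contDiffAt_zpow (-N) hx))
  have hΦ₂ : ContDiff ℝ ∞ Φ₂ :=
    contDiff_radial_cutoff_mul hW hε hW0 fun x _ => contDiffAt_const.mul contDiffAt_id
  have hc₁ : HasCompactSupport Φ₁ := hasCompactSupport_radial_cutoff_mul hWK _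
  have hc₂ : HasCompactSupport Φ₂ := hasCompactSupport_radial_cutoff_mul hWK _
  set Φ : ℂ → ℂ := fun x => Φ₁ x + Φ₂ x with hΦ_def
  have hΦ : ContDiff ℝ ∞ Φ := hΦ₁.add hΦ₂
  have hc : HasCompactSupport Φ := hc₁.add hc₂
  have hΦ₁rot (a : ℂ) (ha : ‖a‖ = 1) (x : ℂ) : Φ₁ (a * x) = a ^ (-(2 * (N + 1))) * a * Φ₁ x := by
    have ha0 : a ≠ 0 := by rintro rfl; simp at ha
    simp only [hΦ₁_def, hF₁, norm_mul, ha, one_mul, map_mul, mul_zpow,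
      star_eq_inv_of_norm_eq_one ha]
    have : a ^ (-(2 * (N + 1))) * a = a⁻¹ ^ (N + 1) * a ^ (-N) := by
      rw [inv_zpow', ← zpow_add_one₀ ha0, ← zpow_add₀ ha0]
      congr 1
      ring
    rw [this]
    ring
  have hΦm : ∀ x, x ≠ 0 → inner ℝ (m x) (planar (Φ x)) = 0 := by
    intro x hx
    have hx' : starRingEnd ℂ x ≠ 0 := by simpa using hx
    rw [inner_planar_eq_re, hS x hx]
    -- The product is a real number times `i (z + z̄)`, hence purely imaginary.
    have hrw : starRingEnd ℂ (S ‖x‖ * e * x ^ (-N)) * Φ x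
        = (S ‖x‖ * W (‖x‖ ^ 2) : ℝ) * (Complex.I * (e * x ^ (-N) * starRingEnd ℂ x
          + starRingEnd ℂ (e * x ^ (-N) * starRingEnd ℂ x))) := by
      simp only [hΦ_def, hΦ₁_def, hΦ₂_def, hF₁, map_mul, Complex.conj_ofReal, he,
        Complex.conj_conj, zpow_add₀ hx', zpow_neg, map_inv₀, map_zpow₀]
      push_cast
      have hz : starRingEnd ℂ x ^ N ≠ 0 := zpow_ne_zero _ hx'
      field_simp
    rw [hrw, Complex.re_ofReal_mul]
    generalize e * x ^ (-N) * starRingEnd ℂ x = z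
    simp
  have hae : ∀ᵐ x : ℂ, x ≠ 0 := by simp [ae_iff, measure_singleton]
  have key := hm.integral_planar hΦ hc (hae.mono hΦm)
  have hlap : ∫ x, inner ℝ (m x) (planar (planeLaplacian Φ x)) = 0 := by
    -- For this `a` both summands of `Φ` are equivariant, while the planar part of `m` picks up
    -- `a^{-N}`; the integrand is multiplied by `a^{N+1} = -1`.
    obtain ⟨a, ha, haN⟩ := exists_norm_eq_one_zpow_eq_neg_one hN1
    have ha0 : a ≠ 0 := by rintro rfl; simp at ha
    have hrot (x : ℂ) : Φ (a * x) = a * Φ x := by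
      have e1 : a ^ (-(2 * (N + 1))) = 1 := by
        rw [zpow_neg, mul_comm, zpow_mul, haN]
        norm_num
      simp only [hΦ_def]
      rw [hΦ₁rot a ha, e1, one_mul, mul_add]
      simp only [hΦ₂_def, norm_mul, ha, one_mul]
      ring
    -- The polar form says nothing about `m 0`; the sign change there needs `ΔΦ(0) = 0`, which
    -- follows from equivariance and `a ≠ 1`.
    have hlap0 : planeLaplacian Φ 0 = 0 := by
      have h1 := planeLaplacian_rotation hΦ ha hrot 0
      have h2 : (1 - a) * planeLaplacian Φ 0 = 0 := by
        rw [mul_zero] at h1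
        linear_combination h1
      rcases mul_eq_zero.1 h2 with h3 | h3
      · have : a = 1 := by linear_combination -h3
        rw [this, one_zpow] at haN
        norm_num at haN
      · exact h3
    refine integral_eq_zero_of_rotation_neg ha fun x => ?_
    by_cases hx : x = 0
    · simp [hx, hlap0]
    · rw [planeLaplacian_rotation hΦ ha hrot, inner_planar_eq_re, inner_planar_eq_re, hS x hx,
        hS (a * x) (mul_ne_zero ha0 hx), norm_mul, ha, one_mul, ← Complex.neg_re]
      congr 1
      have e1 : starRingEnd ℂ (a ^ (-N)) * a = -1 := by
        rw [map_zpow₀, star_eq_inv_of_norm_eq_one ha, inv_zpow', neg_neg, ← zpow_add_one₀ ha0, haN]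
      simp only [map_mul, mul_zpow]
      linear_combination (starRingEnd ℂ (S ‖x‖ : ℂ) * starRingEnd ℂ e * starRingEnd ℂ (x ^ (-N))
        * planeLaplacian Φ x) * e1
  have hcurl₁ : ∫ x, planeCurl Φ₁ x * (m x 2 - 1) = 0 := by
    -- Now `Φ₁(a x) = -a Φ₁(x)`, so its curl changes sign while `m₃` is invariant.
    obtain ⟨a, ha, haN⟩ := exists_norm_eq_one_zpow_eq_neg_one
      (show -(2 * (N + 1)) ≠ 0 by omega)
    have ha0 : a ≠ 0 := by rintro rfl; simp at ha
    have hrot (x : ℂ) : Φ₁ (a * x) = -a * Φ₁ x := by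
      rw [hΦ₁rot a ha, haN]
      ring
    refine integral_eq_zero_of_rotation_neg ha fun x => ?_
    have hneg := planeCurl_rotation_neg hΦ₁ ha hrot
    by_cases hx : x = 0
    · have h1 := hneg 0
      rw [mul_zero] at h1
      have h2 : planeCurl Φ₁ 0 = 0 := by linarith
      simp [hx, h2]
    · rw [hneg, hC x hx, hC (a * x) (mul_ne_zero ha0 hx), norm_mul, ha, one_mul]
      ring
  have hM := integrable_apply_two_sub_one hm.1
  have hadd (x : ℂ) : planeCurl Φ x = planeCurl Φ₁ x + planeCurl Φ₂ x := by
    have hs : HasFDerivAt Φ _ x := ((hΦ₁.differentiable (by simp)) x).hasFDerivAt.add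
      ((hΦ₂.differentiable (by simp)) x).hasFDerivAt
    simp only [planeCurl, hs.fderiv, add_apply, Complex.add_re, Complex.add_im]
    ring
  have hi₁ : Integrable fun x => planeCurl Φ₁ x * (m x 2 - 1) :=
    integrable_test_smul (continuous_planeCurl hΦ₁) (hasCompactSupport_planeCurl hc₁)
      hM.locallyIntegrable
  have hi₂ : Integrable fun x => planeCurl Φ₂ x * (m x 2 - 1) :=
    integrable_test_smul (continuous_planeCurl hΦ₂) (hasCompactSupport_planeCurl hc₂)
      hM.locallyIntegrable
  simp only [hadd, add_mul] at key
  rw [hlap, integral_add hi₁ hi₂, hcurl₁, zero_add, mul_eq_zero] at key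
  simpa only [hΦ₂_def, planeCurl_radial hW] using key.resolve_left two_ne_zero

/-! ### Removing the cutoffs -/

theorem deriv_smoothTransition_of_neg {s : ℝ} (hs : s < 0) :
    deriv Real.smoothTransition s = 0 := by
  have : Real.smoothTransition =ᶠ[𝓝 s] fun _ => 0 := by
    filter_upwards [gt_mem_nhds hs] with y hy using Real.smoothTransition.zero_of_nonpos hy.le
  rw [this.deriv_eq, deriv_const]

theorem deriv_smoothTransition_of_one_lt {s : ℝ} (hs : 1 < s) :
    deriv Real.smoothTransition s = 0 := by
  have : Real.smoothTransition =ᶠ[𝓝 s] fun _ => 1 := by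
    filter_upwards [lt_mem_nhds hs] with y hy using Real.smoothTransition.one_of_one_le hy.le
  rw [this.deriv_eq, deriv_const]

theorem continuous_deriv_smoothTransition : Continuous (deriv Real.smoothTransition) :=
  (Real.smoothTransition.contDiff (n := 1)).continuous_deriv le_rfl

theorem exists_bound_mul_deriv_smoothTransition (δ : ℝ) :
    ∃ C, ∀ s : ℝ, |s * deriv Real.smoothTransition (s - δ)| ≤ C := by
  have hcont : Continuous fun s : ℝ => s * deriv Real.smoothTransition (s - δ) :=
    continuous_id.mul (continuous_deriv_smoothTransition.comp (continuous_id.sub continuous_const))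
  refine hcont.bounded_above_of_compact_support
    (HasCompactSupport.intro (isCompact_Icc (a := δ) (b := δ + 1)) fun s hs => ?_)
  rw [Set.mem_Icc, not_and_or, not_le, not_le] at hs
  rcases hs with hs | hs
  · rw [deriv_smoothTransition_of_neg (by linarith), mul_zero]
  · rw [deriv_smoothTransition_of_one_lt (by linarith), mul_zero]

/-- An axisymmetric critical point with winding number `N ≠ -1` is trivial. -/
theorem IsCriticalPoint.ae_eq_e3 {h : ℝ} {N : ℤ} (hN : N ≠ -1) {γ : ℝ} {m : ℂ → R3}
    (hm : IsCriticalPoint h m) (hax : IsAxisymmetric N γ m) : ∀ᵐ x, m x = e3 := by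
  have hM := integrable_apply_two_sub_one hm.1
  have hM0 : ∀ᵐ x, m x 2 - 1 ≤ 0 := by
    filter_upwards [hm.1.1] with x hx
    have := (le_abs_self _).trans (PiLp.norm_apply_le (m x) 2)
    linarith
  have hσ0 := Real.smoothTransition.nonneg
  have hσ1 := Real.smoothTransition.le_one
  have hσd (s : ℝ) : 0 ≤ deriv Real.smoothTransition s :=
    Real.smoothTransition.monotone.deriv_nonneg
  have key (ε : ℝ) (hε : 0 < ε) : ∀ᵐ x : ℂ, ε < ‖x‖ ^ 2 → m x 2 - 1 = 0 := by
    obtain ⟨C₁, hC₁⟩ := exists_bound_mul_deriv_smoothTransition ε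
    obtain ⟨C₂, hC₂⟩ := exists_bound_mul_deriv_smoothTransition 1
    -- The weight left once the outer cutoff is gone; monotonicity of the transition makes it
    -- nonnegative, and positive where `‖x‖² > ε`.
    set g : ℂ → ℝ := fun x => 2 * Real.smoothTransition (‖x‖ ^ 2 - ε)
      + 2 * (‖x‖ ^ 2 * deriv Real.smoothTransition (‖x‖ ^ 2 - ε)) with hg
    set W : ℕ → ℝ → ℝ := fun n s => Real.smoothTransition (s - ε)
      * (1 - Real.smoothTransition (s / (n + 1) - 1)) with hW_def
    have hW (n : ℕ) : ContDiff ℝ ∞ (W n) :=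
      (Real.smoothTransition.contDiff.comp (contDiff_id.sub contDiff_const)).mul
        (contDiff_const.sub (Real.smoothTransition.contDiff.comp
          ((contDiff_id.div_const _).sub contDiff_const)))
    have hWd (n : ℕ) (s : ℝ) : deriv (W n) s
        = deriv Real.smoothTransition (s - ε) * (1 - Real.smoothTransition (s / (n + 1) - 1))
          - Real.smoothTransition (s - ε)
            * (deriv Real.smoothTransition (s / (n + 1) - 1) / (n + 1)) := by
      have hd (y : ℝ) : HasDerivAt Real.smoothTransition (deriv Real.smoothTransition y) y :=
        ((Real.smoothTransition.contDiff (n := 1)).differentiable one_ne_zero y).hasDerivAt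
      have h1 : HasDerivAt (fun s => Real.smoothTransition (s - ε)) _ s :=
        (hd _).comp s ((hasDerivAt_id s).sub_const ε)
      have h2 : HasDerivAt (fun s : ℝ => Real.smoothTransition (s / (n + 1) - 1)) _ s :=
        (hd _).comp s (((hasDerivAt_id s).div_const ((n : ℝ) + 1)).sub_const 1)
      have h3 : HasDerivAt (W n) _ s := h1.mul (h2.const_sub 1)
      rw [h3.deriv]
      ring
    have hzero (n : ℕ) := integral_radial_eq_zero hN hm hax (hW n) hε (K := 2 * (n + 1))
      (fun s hs => by simp [hW_def, Real.smoothTransition.zero_of_nonpos (sub_nonpos.2 hs)])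
      (fun s hs => by
        have h1 : 1 ≤ s / ((n : ℝ) + 1) - 1 := by
          rw [le_sub_iff_add_le, le_div_iff₀ (by positivity)]
          linarith
        simp [hW_def, Real.smoothTransition.one_of_one_le h1])
    have hgc : Continuous g := by
      have h1 := continuous_deriv_smoothTransition
      have h2 := Real.smoothTransition.continuous
      fun_prop
    have hlim : Tendsto (fun n : ℕ => ∫ x : ℂ, (2 * W n (‖x‖ ^ 2)
        + 2 * (‖x‖ ^ 2 * deriv (W n) (‖x‖ ^ 2))) * (m x 2 - 1)) atTop
        (𝓝 (∫ x : ℂ, g x * (m x 2 - 1))) := by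
      refine tendsto_integral_of_dominated_convergence
        (fun x => (2 + 2 * (C₁ + C₂)) * |m x 2 - 1|) (fun n => ?_)
        (hM.norm.const_mul _) (fun n => Eventually.of_forall fun x => ?_)
        (Eventually.of_forall fun x => ?_)
      · have h1 := (hW n).continuous
        have h2 := (hW n).continuous_deriv (by simp)
        exact Continuous.aestronglyMeasurable (by fun_prop) |>.mul hM.1
      · rw [norm_mul, Real.norm_eq_abs, Real.norm_eq_abs]
        refine mul_le_mul_of_nonneg_right ?_ (abs_nonneg _)
        generalize ‖x‖ ^ 2 = s
        have ha0 := hσ0 (s - ε)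
        have ha1 := hσ1 (s - ε)
        have hb0 := hσ0 (s / (n + 1) - 1)
        have hb1 := hσ1 (s / (n + 1) - 1)
        -- The outer cutoff enters through `y σ'(y - 1)` at `y = s/(n+1)`, with `σ` the smooth
        -- transition, so `C₂` bounds it uniformly in `n`.
        have e : 2 * W n s + 2 * (s * deriv (W n) s)
            = 2 * (Real.smoothTransition (s - ε) * (1 - Real.smoothTransition (s / (n + 1) - 1)))
              + (2 * (s * deriv Real.smoothTransition (s - ε)
                  * (1 - Real.smoothTransition (s / (n + 1) - 1)))
              - 2 * (s / (n + 1) * deriv Real.smoothTransition (s / (n + 1) - 1)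
                  * Real.smoothTransition (s - ε))) := by
          rw [hWd]
          simp only [hW_def]
          ring
        have hmul {u v c : ℝ} (hu : |u| ≤ c) (hv0 : 0 ≤ v) (hv1 : v ≤ 1) : |u * v| ≤ c := by
          rw [abs_mul, abs_of_nonneg hv0]
          exact (mul_le_of_le_one_right (abs_nonneg u) hv1).trans hu
        have t1 := hmul (abs_le.2 ⟨by linarith, ha1⟩)
          (sub_nonneg.2 hb1) (by linarith : 1 - Real.smoothTransition (s / (n + 1) - 1) ≤ 1)
        have t2 := hmul (hC₁ s) (sub_nonneg.2 hb1)
          (by linarith : 1 - Real.smoothTransition (s / (n + 1) - 1) ≤ 1)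
        have t3 := hmul (hC₂ (s / (n + 1))) ha0 ha1
        rw [e]
        rw [abs_le] at t1 t2 t3 ⊢
        constructor <;> linarith [t1.1, t1.2, t2.1, t2.2, t3.1, t3.2]
      · refine tendsto_const_nhds.congr' ?_
        filter_upwards [eventually_ge_atTop ⌈‖x‖ ^ 2⌉₊] with n hn
        have h1 : ‖x‖ ^ 2 < (n : ℝ) + 1 := by
          have := (Nat.le_ceil (‖x‖ ^ 2)).trans (Nat.cast_le.2 hn)
          linarith
        have h2 : ‖x‖ ^ 2 / ((n : ℝ) + 1) - 1 < 0 := by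
          rw [sub_neg, div_lt_one (by positivity)]
          exact h1
        rw [hWd]
        simp only [hW_def, hg, deriv_smoothTransition_of_neg h2,
          Real.smoothTransition.zero_of_nonpos h2.le]
        ring
    simp only [hzero] at hlim
    have hint : ∫ x : ℂ, g x * (m x 2 - 1) = 0 := (tendsto_nhds_unique hlim tendsto_const_nhds)
    have hg0 (x : ℂ) : 0 ≤ g x := by
      have := hσ0 (‖x‖ ^ 2 - ε)
      have := hσd (‖x‖ ^ 2 - ε)
      positivity
    have hgC (x : ℂ) : ‖g x‖ ≤ 2 + 2 * C₁ := by
      rw [Real.norm_eq_abs, abs_of_nonneg (hg0 x)]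
      have := hσ1 (‖x‖ ^ 2 - ε)
      have := (le_abs_self _).trans (hC₁ (‖x‖ ^ 2))
      simp only [hg]
      linarith
    have hgi : Integrable fun x => g x * (m x 2 - 1) :=
      hM.bdd_mul hgc.aestronglyMeasurable (Eventually.of_forall hgC)
    -- An integrand of one sign with zero integral vanishes almost everywhere.
    have hneg : 0 ≤ᵐ[volume] fun x => -(g x * (m x 2 - 1)) := by
      filter_upwards [hM0] with x hx
      simpa using mul_nonpos_of_nonneg_of_nonpos (hg0 x) hx
    have hae := (integral_eq_zero_iff_of_nonneg_ae hneg hgi.neg).1 (by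
      rw [integral_neg, hint, neg_zero])
    filter_upwards [hae] with x hx hxε
    have h1 : g x * (m x 2 - 1) = 0 := by simpa using hx
    refine (mul_eq_zero.1 h1).resolve_left (ne_of_gt ?_)
    have := Real.smoothTransition.pos_of_pos (sub_pos.2 hxε)
    have := hσd (‖x‖ ^ 2 - ε)
    positivity
  -- Countably many radii exhaust the punctured plane.
  have hall := ae_all_iff.2 fun n : ℕ => key (1 / ((n : ℝ) + 1)) (by positivity)
  have hne : ∀ᵐ x : ℂ, x ≠ 0 := by simp [ae_iff, measure_singleton]
  filter_upwards [hall, hne, hm.1.1] with x hx hx0 hx1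
  have hpos : 0 < ‖x‖ ^ 2 := by positivity
  obtain ⟨n, hn⟩ := exists_nat_one_div_lt hpos
  exact eq_e3_of_norm_of_apply_two hx1 (by linarith [hx n hn])

end ChiralMagnet

end

theorem mainTheorem4 (h : ℝ) (N : ℤ) (hN0 : N ≠ 0) (hN1 : N ≠ -1) (γ : ℝ) :
    ¬ ∃ m : ℂ → ChiralMagnet.R3,
      ChiralMagnet.IsCriticalPoint h m ∧ ChiralMagnet.IsAxisymmetric N γ m ∧
        ¬ (∀ᵐ x ∂(MeasureTheory.volume : MeasureTheory.Measure ℂ), m x = ChiralMagnet.e3) := by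
  rintro ⟨m, hm, hax, hne⟩
  exact hne (hm.ae_eq_e3 hN1 hax)
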